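/- A (rooted) tree $T=\langle T,<_T\rangle$ is a strict partial order on a set with a least node $\emptyset$ in which every set $\mathrm{pred}(t)=\{s\in T: s<_T t\}$ is well-ordered; the height of $t$ is the order type of $\mathrm{pred}(t)$, the height of $T$ is the supremum of the ordinals $\mathrm{ht}(t)+1$, and $t$ is a limit node if its height is a nonzero limit ordinal. Let $\nu$ be an infinite cardinal, and let $T$ be a tree of height $\nu^+$. A subset $U\subseteq T$ is $\nu$-special if it is a union of at most $\nu$ antichains. Put $\mathrm{cone}(t)=\{s\in T: t<_T s\}$ for $t\neq\emptyset$ and $\mathrm{cone}(\emptyset)=T$. A subset $B\subseteq T$ is nonstationary, written $B\in NS^T_\nu$, if $B=\bigcup_{t\in T}(A_t\cap \mathrm{cone}(t))$ for some $\nu$-special sets $A_t\subseteq T$ $(t\in T)$; otherwise $B$ is stationary. Let $\kappa$ be an infinite cardinal and $\theta$ a regular cardinal with $T\in H(\theta)$. A $\kappa$-very nice collection of elementary submodels of $H(\theta)$ indexed by $T$ is a family $\langle N_t\rangle_{t\in T}$ such that $|N_t|<\nu^+$, $N_t\prec H(\theta)$ and $\mathrm{pred}(t)\subseteq N_t$ for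 every $t\in T$; $N_s\subseteq N_t$, $N_s\in N_t$ and $[N_s]^{<\kappa}\subseteq N_t$ whenever $s<_T t$; and $N_t=\bigcup_{s<_T t}N_s$ for every limit node $t$. For $N\prec H(\theta)$ with $T\in N$, and $t\in T$, let $$\mathcal G_{N,t}=\{A\cap \mathrm{pred}(t): A\in\mathcal P(T)\cap N,\ t\notin A\},\qquad I_{N,t}=\{X\subseteq \mathrm{pred}(t): X\subseteq Y \text{ for some } Y\in\mathcal G_{N,t}\},$$ and $I^+_{N,t}=\mathcal P(\mathrm{pred}(t))\setminus I_{N,t}$. **Lemma.** Suppose that $T$ (of height $\nu^+$) is non-$\nu$-special, that is, $T$ is not a $\nu$-special subset of itself, and let $\langle N_t\rangle_{t\in T}$ be a $\kappa$-very nice collection of elementary submodels of $H(\theta)$ indexed by $T$ with $T\in N_\emptyset$. Then for every $S\subseteq T$, $$\{t\in S: S\cap \mathrm{pred}(t)\in I_{N_t,t}\}\in NS^T_\nu .$$ Calling $t\in T$ a reflection point of $S$ if $S\cap\mathrm{pred}(t)\in I^+_{N_t,t}$, the set of points of $S$ that are not reflection points of $S$ is therefore nonstationary. (So if $S$ is stationary,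 almost every point of $S$ is a reflection point of $S$.) -/

import Mathlib

open Cardinal

universe u

/-! ### The structures `(H(θ), ∈)` and their elementary submodels -/

/-- The only symbol of the language of set theory: the binary relation symbol `∈`. -/
inductive SetLangRel : ℕ → Type
  | mem : SetLangRel 2

/-- The first-order language of set theory. -/
def setLanguage : FirstOrder.Language.{0, 0} := ⟨fun _ => Empty, SetLangRel⟩

/-- `H(θ)`: the sets whose transitive closure has fewer than `θ` elements. The transitive closure
of `x` consists of the `y` with `y ∈ x₁ ∈ ⋯ ∈ xₙ ∈ x` for some `n ≥ 0`. -/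
def hereditary (θ : Cardinal.{u}) : Set ZFSet.{u} :=
  {x | #{y : ZFSet.{u} // Relation.TransGen (fun a b : ZFSet.{u} => a ∈ b) y x}
    < Cardinal.lift.{u + 1} θ}

/-- `H(θ)` as a first-order structure, with the symbol `∈` interpreted as membership. -/
instance hereditaryStructure (θ : Cardinal.{u}) : setLanguage.Structure (hereditary θ) where
  funMap := fun f _ => Empty.elim f
  RelMap := fun r => match r with
    | SetLangRel.mem => fun v => (v 0 : ZFSet.{u}) ∈ (v 1 : ZFSet.{u})

/-- `N ≺ H(θ)`: the set `N` is (the universe of) an elementary submodel of `(H(θ), ∈)`. -/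
def IsElementarySubmodel (N : ZFSet.{u}) (θ : Cardinal.{u}) : Prop :=
  (∀ x ∈ N, x ∈ hereditary θ) ∧
    ∃ M : setLanguage.ElementarySubstructure (hereditary θ),
      ∀ x : hereditary θ, x ∈ M ↔ (x : ZFSet.{u}) ∈ N

/-! ### Trees -/

/-- A (rooted, set-theoretic) tree: a set together with a set of ordered pairs that is a strict
partial order on it, such that the predecessors of each node are well-ordered and there is a
least node. -/
structure SetTree : Type (u + 1) where
  carrier : ZFSet.{u}
  rel : ZFSet.{u}
  rel_subset : rel ⊆ carrier.prod carrier
  irrefl : ∀ t, ZFSet.pair t t ∉ rel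
  trans : ∀ r s t, ZFSet.pair r s ∈ rel → ZFSet.pair s t ∈ rel → ZFSet.pair r t ∈ rel
  wellOrder : ∀ t, IsWellOrder {s : ZFSet.{u} // ZFSet.pair s t ∈ rel}
    (fun a b => ZFSet.pair a.1 b.1 ∈ rel)
  exists_root : ∃ r ∈ carrier, ∀ t ∈ carrier, t = r ∨ ZFSet.pair r t ∈ rel

namespace SetTree

/-- The tree as a set, namely the ordered pair of its set of nodes and its order relation. -/
noncomputable def toZFSet (T : SetTree.{u}) : ZFSet.{u} := ZFSet.pair T.carrier T.rel

/-- The nodes of a tree. -/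
structure Node (T : SetTree.{u}) : Type (u + 1) where
  val : ZFSet.{u}
  mem : val ∈ T.carrier

/-- The tree order. -/
instance (T : SetTree.{u}) : LT T.Node := ⟨fun s t => ZFSet.pair s.val t.val ∈ T.rel⟩

variable (T : SetTree.{u})

/-- The height of a node: the order type of its set of predecessors. -/
noncomputable def nodeHeight (t : T.Node) : Ordinal.{u + 1} :=
  haveI := T.wellOrder t.val
  Ordinal.type (fun a b : {s : ZFSet.{u} // ZFSet.pair s t.val ∈ T.rel} =>
    ZFSet.pair a.1 b.1 ∈ T.rel)

/-- The height of a tree: the supremum of the ordinals `ht(t) + 1`. -/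
noncomputable def height : Ordinal.{u + 1} := ⨆ t : T.Node, Order.succ (T.nodeHeight t)

/-- A limit node is one whose height is a (nonzero) limit ordinal. -/
def IsLimitNode (t : T.Node) : Prop := Order.IsSuccLimit (T.nodeHeight t)

/-- The root: the least node. -/
def IsRoot (t : T.Node) : Prop := ∀ s : T.Node, s = t ∨ t < s

/-- The set of predecessors of a node. -/
def pred (t : T.Node) : Set T.Node := {s | s < t}

/-- The cone above `t`; it does not contain `t`, except that the cone above the root is the whole
tree. -/
def cone (t : T.Node) : Set T.Node := {s | t < s ∨ T.IsRoot t}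

/-- The diagonal union of a family of subsets of the tree indexed by the nodes. -/
def diagUnion (A : T.Node → Set T.Node) : Set T.Node := ⋃ t, A t ∩ T.cone t

/-- `U` is a `ν`-special subtree: a union of at most `ν` antichains. -/
def IsSpecial (ν : Cardinal.{u}) (U : Set T.Node) : Prop :=
  ∃ F : Set (Set T.Node), #F ≤ Cardinal.lift.{u + 1} ν ∧
    (∀ A ∈ F, IsAntichain (fun s t : T.Node => s < t) A) ∧ U = ⋃₀ F

/-- `B` is a `ν`-nonstationary subtree: a diagonal union of `ν`-special subtrees. -/
def IsNonstationary (ν : Cardinal.{u}) (B : Set T.Node) : Prop :=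
  ∃ A : T.Node → Set T.Node, (∀ t, T.IsSpecial ν (A t)) ∧ B = T.diagUnion A

/-! ### Nice collections indexed by a tree -/

/-- A nice collection of sets indexed by a tree `T` (of height `lam`). -/
structure IsNiceCollection (lam : Cardinal.{u}) (W : T.Node → ZFSet.{u}) : Prop where
  card_lt : ∀ t, (W t).card < lam
  increasing : ∀ s t : T.Node, s < t → W s ⊆ W t
  continuous : ∀ t : T.Node, T.IsLimitNode t → ∀ x, x ∈ W t ↔ ∃ s : T.Node, s < t ∧ x ∈ W s

/-- A nice collection of elementary submodels of `H(θ)` indexed by a tree `T` (of height `lam`). -/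
structure IsNiceModels (lam θ : Cardinal.{u}) (N : T.Node → ZFSet.{u}) : Prop
    extends T.IsNiceCollection lam N where
  elementary : ∀ t, IsElementarySubmodel (N t) θ
  pred_subset : ∀ s t : T.Node, s < t → s.val ∈ N t
  model_mem : ∀ s t : T.Node, s < t → N s ∈ N t

/-- A `κ`-very nice collection of elementary submodels of `H(θ)` indexed by a tree `T` (of height
`lam`): moreover `[N_s]^{<κ} ⊆ N_t` whenever `s < t`. -/
structure IsVeryNiceModels (lam θ κ : Cardinal.{u}) (N : T.Node → ZFSet.{u}) : Prop
    extends T.IsNiceModels lam θ N where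
  small_subset_mem : ∀ s t : T.Node, s < t → ∀ x : ZFSet.{u}, x ⊆ N s → x.card < κ → x ∈ N t

/-! ### The ideals determined by a model and a node -/

/-- `𝒢_{N,t} = {A ∩ pred(t) : A ∈ 𝒫(T) ∩ N, t ∉ A}`. -/
def modelIdealBase (N : ZFSet.{u}) (t : T.Node) : Set (Set T.Node) :=
  {Y | ∃ A ∈ N, A ⊆ T.carrier ∧ t.val ∉ A ∧ Y = {s | s.val ∈ A} ∩ T.pred t}

/-- `I_{N,t}`: the ideal on `pred(t)` (that is, in its whole power set) generated by
`𝒢_{N,t}`. -/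
def modelIdeal (N : ZFSet.{u}) (t : T.Node) : Set (Set T.Node) :=
  {X | X ⊆ T.pred t ∧ ∃ Y ∈ T.modelIdealBase N t, X ⊆ Y}

/-- The co-ideal `I⁺_{N,t} = 𝒫(pred(t)) \ I_{N,t}`. -/
def modelCoideal (N : ZFSet.{u}) (t : T.Node) : Set (Set T.Node) :=
  {X | X ⊆ T.pred t ∧ X ∉ T.modelIdeal N t}

/-- `t` is a reflection point of `S` (with respect to the collection `N`). -/
def IsReflectionPoint (N : T.Node → ZFSet.{u}) (S : Set T.Node) (t : T.Node) : Prop :=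
  S ∩ T.pred t ∈ T.modelCoideal (N t) t

end SetTree

namespace SetTree

variable {T : SetTree.{u}}

/-! This is a pressing-down argument. If `t` is a limit node of `S` with `S ∩ pred(t)` in the ideal,
a witness `A ∈ N t` contains `S ∩ pred(t)` but omits `t`. By continuity `A` already lies in `N s`
for some `s < t`, so `t` is in the cone of `s`. For fixed `A`, the nodes so witnessed form an
antichain: were `t < t'` two of them, then `t ∈ S ∩ pred(t') ⊆ A`. As `N s` has at most `ν`
elements, each `s` contributes a `ν`-special set. The remaining nodes are the root and immediate
successors, and the immediate successors of a given `s` form one more antichain. -/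

/-- `t` is an immediate successor of `s`. -/
def IsImmediateSucc (s t : T.Node) : Prop := s < t ∧ ∀ r < t, r = s ∨ r < s

theorem node_lt_irrefl (t : T.Node) : ¬ t < t := T.irrefl t.val

theorem node_lt_trans {r s t : T.Node} (h₁ : r < s) (h₂ : s < t) : r < t :=
  T.trans r.val s.val t.val h₁ h₂

theorem mem_carrier_of_rel {s t : ZFSet.{u}} (h : ZFSet.pair s t ∈ T.rel) : s ∈ T.carrier :=
  (ZFSet.pair_mem_prod.1 (T.rel_subset h)).1

/-- A node that is not a limit node is the root or an immediate successor. -/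
theorem isRoot_or_isImmediateSucc_of_not_isLimitNode {t : T.Node} (ht : ¬ T.IsLimitNode t) :
    T.IsRoot t ∨ ∃ s, IsImmediateSucc s t := by
  have := T.wellOrder t.val
  rcases Ordinal.zero_or_succ_or_isSuccLimit (T.nodeHeight t) with h | ⟨o, ho⟩ | h
  · left
    have hempty := Ordinal.type_eq_zero_iff_isEmpty.1 h
    obtain ⟨r, hr, hmin⟩ := T.exists_root
    have htr : t.val = r := (hmin t.val t.mem).resolve_right fun h' => hempty.false ⟨r, h'⟩
    intro s
    rcases hmin s.val s.mem with h' | h'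
    · left
      cases s
      cases t
      simp_all
    · right
      change ZFSet.pair t.val s.val ∈ T.rel
      rwa [htr]
  · right
    let R := fun a b : {s : ZFSet.{u} // ZFSet.pair s t.val ∈ T.rel} =>
      ZFSet.pair a.1 b.1 ∈ T.rel
    have htype : Ordinal.type R = Order.succ o := ho.symm
    have hlt : o < Ordinal.type R := by
      rw [htype]
      exact Order.lt_succ o
    -- The predecessors have order type `o + 1`, so the one in position `o` is the largest.
    let m := Ordinal.enum R ⟨o, hlt⟩
    refine ⟨⟨m.1, mem_carrier_of_rel m.2⟩, m.2, fun r hr => ?_⟩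
    let a : {s : ZFSet.{u} // ZFSet.pair s t.val ∈ T.rel} := ⟨r.val, hr⟩
    have hle : Ordinal.typein R a ≤ Ordinal.typein R m := by
      rw [Ordinal.typein_enum R hlt, ← Order.lt_succ_iff, ← htype]
      exact Ordinal.typein_lt_type R a
    rcases hle.eq_or_lt with h | h
    · left
      have ham : a = m := Ordinal.typein_injective R h
      cases r
      simp [← ham, a]
    · right
      exact (Ordinal.typein_lt_typein R).1 h
  · exact absurd h ht

theorem isAntichain_setOf_isImmediateSucc (s : T.Node) :
    IsAntichain (fun s t : T.Node => s < t) {t | IsImmediateSucc s t} := by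
  intro t ht t' ht' _ hlt
  rcases ht'.2 t hlt with rfl | h
  · exact node_lt_irrefl _ ht.1
  · exact node_lt_irrefl _ (node_lt_trans ht.1 h)

theorem isAntichain_setOf_isRoot :
    IsAntichain (fun s t : T.Node => s < t) {t | T.IsRoot t} := by
  intro t ht t' ht' hne hlt
  exact (ht' t).elim hne fun h => node_lt_irrefl _ (node_lt_trans hlt h)

/-- The points of `S` outside `A` all of whose predecessors in `S` lie in `A` form an antichain. -/
theorem isAntichain_setOf_inter_pred_subset (S A : Set T.Node) :
    IsAntichain (fun s t : T.Node => s < t) {t ∈ S | t ∉ A ∧ S ∩ T.pred t ⊆ A} :=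
  fun _ ht _ ht' _ hlt => ht.2.1 (ht'.2.2 ⟨ht.1, hlt⟩)

theorem isSpecial_iUnion {ν : Cardinal.{u}} {ι : Type (u + 1)} (hι : #ι ≤ Cardinal.lift.{u + 1} ν)
    {A : ι → Set T.Node} (hA : ∀ i, IsAntichain (fun s t : T.Node => s < t) (A i)) :
    T.IsSpecial ν (⋃ i, A i) :=
  ⟨Set.range A, Cardinal.mk_range_le.trans hι, Set.forall_mem_range.2 hA, by rw [Set.sUnion_range]⟩

theorem mem_cone_of_isRoot {t : T.Node} (ht : T.IsRoot t) (s : T.Node) : s ∈ T.cone t := Or.inr ht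

theorem mem_cone_of_lt {s t : T.Node} (h : s < t) : t ∈ T.cone s := Or.inl h

/-- The points `t` of `S` at which `S ∩ pred(t)` belongs to the ideal given by a nice collection of
sets form a nonstationary set. -/
theorem isNonstationary_setOf_inter_pred_mem_modelIdeal {ν : Cardinal.{u}} (hν : ℵ₀ ≤ ν)
    {N : T.Node → ZFSet.{u}} (hN : T.IsNiceCollection (Order.succ ν) N) (S : Set T.Node) :
    T.IsNonstationary ν {t ∈ S | S ∩ T.pred t ∈ T.modelIdeal (N t) t} := by
  set B := {t ∈ S | S ∩ T.pred t ∈ T.modelIdeal (N t) t}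
  -- One antichain for each possible witness in `N s`, and two more for the non-limit nodes.
  let P (s : T.Node) : Option (Option {A // A ∈ N s}) → Set T.Node
    | none => {t | T.IsRoot t}
    | some none => {t | IsImmediateSucc s t}
    | some (some A) => {t ∈ S | t ∉ {r : T.Node | r.val ∈ A.1} ∧
        S ∩ T.pred t ⊆ {r : T.Node | r.val ∈ A.1}}
  -- Cutting down to `B` keeps every piece an antichain and makes the diagonal union equal to `B`,
  -- not merely a superset.
  refine ⟨fun s => ⋃ i, B ∩ P s i, fun s => isSpecial_iUnion ?_ fun i => ?_, ?_⟩
  · have hcard : #{A // A ∈ N s} ≤ Cardinal.lift.{u + 1} ν := by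
      have h : #{A // A ∈ N s} = Cardinal.lift.{u + 1} (N s).card := ZFSet.cardinalMk_coe_sort
      rw [h, Cardinal.lift_le]
      exact Order.lt_succ_iff.1 (hN.card_lt s)
    have hν' : ℵ₀ ≤ Cardinal.lift.{u + 1} ν := by simpa using hν
    rw [Cardinal.mk_option, Cardinal.mk_option]
    -- The two extra indices are absorbed because `ν` is infinite.
    refine (add_le_add_left (add_le_add_left hcard 1) 1).trans ?_
    rw [Cardinal.add_one_eq hν', Cardinal.add_one_eq hν']
  · refine IsAntichain.subset ?_ Set.inter_subset_right
    match i with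
    | none => exact isAntichain_setOf_isRoot
    | some none => exact isAntichain_setOf_isImmediateSucc s
    | some (some A) => exact isAntichain_setOf_inter_pred_subset S _
  · ext t
    simp only [diagUnion, Set.mem_iUnion, Set.mem_inter_iff]
    refine ⟨fun ht => ?_, by rintro ⟨_, ⟨_, ht, -⟩, -⟩; exact ht⟩
    by_cases hlim : T.IsLimitNode t
    · obtain ⟨htS, -, Y, ⟨A, hA, -, htA, rfl⟩, hY⟩ := id ht
      -- The regressive step: the witness appears at an earlier node.
      obtain ⟨s, hst, hAs⟩ := (hN.continuous t hlim A).1 hA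
      exact ⟨s, ⟨some (some ⟨A, hAs⟩), ht, htS, htA, hY.trans Set.inter_subset_left⟩,
        mem_cone_of_lt hst⟩
    · rcases isRoot_or_isImmediateSucc_of_not_isLimitNode hlim with h | ⟨s, hs⟩
      -- The root lies above no node, so it is caught only because its own cone is the whole tree.
      · exact ⟨t, ⟨none, ht, h⟩, mem_cone_of_isRoot h t⟩
      · exact ⟨s, ⟨some none, ht, hs⟩, mem_cone_of_lt hs.1⟩

/-- The co-ideal is a complement within the power set of `pred(t)`, where `S ∩ pred(t)` always lies;
hence both conclusions of the main theorem concern the same set. -/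
theorem not_isReflectionPoint_iff {N : T.Node → ZFSet.{u}} {S : Set T.Node} {t : T.Node} :
    ¬ T.IsReflectionPoint N S t ↔ S ∩ T.pred t ∈ T.modelIdeal (N t) t := by
  simp [IsReflectionPoint, modelCoideal]

end SetTree

theorem mainTheorem12 (ν κ θ : Cardinal.{u}) (hν : ℵ₀ ≤ ν) (hκ : ℵ₀ ≤ κ) (hθ : θ.IsRegular)
    (T : SetTree.{u})
    (hheight : T.height = (Cardinal.lift.{u + 1} (Order.succ ν)).ord)
    (hspecial : ¬ T.IsSpecial ν Set.univ)
    (hTθ : T.toZFSet ∈ hereditary θ)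
    (N : T.Node → ZFSet.{u})
    (hN : T.IsVeryNiceModels (Order.succ ν) θ κ N)
    (hTN : ∀ r : T.Node, T.IsRoot r → T.toZFSet ∈ N r)
    (S : Set T.Node) :
    T.IsNonstationary ν {t ∈ S | S ∩ T.pred t ∈ T.modelIdeal (N t) t} ∧
      T.IsNonstationary ν {t ∈ S | ¬ T.IsReflectionPoint N S t} := by
  have h := SetTree.isNonstationary_setOf_inter_pred_mem_modelIdeal hν hN.toIsNiceCollection S
  simp only [SetTree.not_isReflectionPoint_iff]
  exact ⟨h, h⟩
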